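/- Let $f_k=\prod_{i\ge 1}(1-q^{ki})$ for $k\ge 1$, and let the integers $M(n)$, $n\ge 0$, be defined by the formal power series identity \[ \sum_{n\ge 0}M(n)q^n=\frac{f_2^5f_5^5}{f_1f_{10}}. \] Then for all integers $n\ge 0$ and $\alpha\ge 1$, \[ M(5^{\alpha}n+5^{\alpha}-1)\equiv 0\pmod{5^{\alpha}}. \] -/

import Mathlib

open PowerSeries
open scoped PowerSeries.WithPiTopology

/-- The formal power series `f_k = (q^k; q^k)_∞ = ∏_{i ≥ 0} (1 - q^{k (i + 1)})`, as an infinite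
product in `ℤ⟦q⟧` with the coefficientwise topology (`ℤ` is discrete). Used for `k ≥ 1`. -/
noncomputable def fq (k : ℕ) : PowerSeries ℤ :=
  ∏' i : ℕ, (1 - (X : PowerSeries ℤ) ^ (k * (i + 1)))

/-- The infinite product defining `fq k` converges for `k ≥ 1`. -/
theorem fq_multipliable (k : ℕ) (hk : 1 ≤ k) :
    Multipliable fun i : ℕ => 1 - (X : PowerSeries ℤ) ^ (k * (i + 1)) := by
  have h : Filter.Tendsto (fun i : ℕ => (-(X : PowerSeries ℤ) ^ (k * (i + 1))).order)
      Filter.atTop (nhds ⊤) := by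
    refine ENat.tendsto_nhds_top_iff_natCast_lt.mpr fun n => Filter.eventually_atTop.mpr ⟨n, ?_⟩
    intro m hm
    rw [order_neg, order_X_pow]
    have : n < k * (m + 1) := by nlinarith
    exact_mod_cast this
  simpa [sub_eq_add_neg] using
    PowerSeries.WithPiTopology.multipliable_one_add_of_tendsto_order_atTop_nhds_top ℤ h

/-- The constant term of `fq k` is `1`. -/
theorem constantCoeff_fq (k : ℕ) (hk : 1 ≤ k) : constantCoeff (fq k) = 1 := by
  unfold fq
  rw [(fq_multipliable k hk).map_tprod (constantCoeff (R := ℤ))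
    (PowerSeries.WithPiTopology.continuous_constantCoeff ℤ)]
  have h : ∀ i : ℕ, k * (i + 1) ≠ 0 := fun i => by positivity
  simp [h]

/-- The power series `f_2^5 f_5^5 / (f_1 f_10)`; the inverse is taken in `ℤ⟦q⟧`, where
`f_1 f_10` is invertible because it has constant term `1`. -/
noncomputable def genM : PowerSeries ℤ :=
  fq 2 ^ 5 * fq 5 ^ 5 * invOfUnit (fq 1 * fq 10) 1

/-- `genM` is indeed the quotient of `f_2^5 f_5^5` by `f_1 f_10`. -/
theorem genM_mul : genM * (fq 1 * fq 10) = fq 2 ^ 5 * fq 5 ^ 5 := by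
  have h : fq 1 * fq 10 * invOfUnit (fq 1 * fq 10) 1 = 1 :=
    mul_invOfUnit _ _ (by simp [constantCoeff_fq])
  unfold genM
  linear_combination (fq 2 ^ 5 * fq 5 ^ 5) * h

/-- The numbers `M(n)`, defined by `∑_{n ≥ 0} M(n) q^n = f_2^5 f_5^5 / (f_1 f_10)`. -/
noncomputable def pvM (n : ℕ) : ℤ := coeff n genM

/-! Put Φ(q) = f_1^5/f_2 (`phiJacobi`) and Ψ(q) = f_2^5/f_1 (`psiJacobi`), so that the generating
function is Φ(q^5)Ψ(q). Both are products of two theta series: Φ = (f_1^2/f_2)·f_1^3 has exponents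
k² + T_l, and Ψ = (f_2^2/f_1)·f_2^3 has exponents T_k + 2T_l, where T_k = k(k+1)/2.

Modulo 5, squares are 0, 1, 4 and triangular numbers are 0, 1, 3. Hence k² + T_l ≡ 3 forces k ≡ 0, l
≡ 2, and T_k + 2T_l ≡ 4 forces k ≡ l ≡ 2. Since (5k)² = 25k², T_{5l+2} = 25T_l + 3, and Jacobi's
weight (-1)^l(2l+1) is multiplied by 5 under l ↦ 5l+2, the 5n+3 part of Φ is 5Φ(q^5) and the 5n+4
part of Ψ is 5qΨ(q^5) (`coeff_phiJacobi`, `coeff_psiJacobi`).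

One dissection of Φ(q^5)Ψ(q) therefore gives 5qΨ(q^5)Φ(q), which settles α = 1. A second one returns
to the start: M(25n+24) = 25M(n) (`pvM_twentyFive`). Induction on α in steps of two finishes.

The theta expansions all come from one finite triple product (`prod_mul_prod_eq_sum_gaussBinom`),
with the limit taken modulo every X^m. -/

/-- The number `z (z + 1) / 2`, for an integer `z`. -/
def triNum (z : ℤ) : ℕ := (z * (z + 1) / 2).toNat

theorem two_mul_triNum (z : ℤ) : 2 * (triNum z : ℤ) = z * (z + 1) := by
  have h : 0 ≤ z * (z + 1) := by
    rcases le_or_gt 0 z with h | h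
    · positivity
    · nlinarith
  obtain ⟨c, hc⟩ := (Int.even_mul_succ_self z).two_dvd
  unfold triNum
  rw [hc] at h ⊢
  rw [Int.mul_ediv_cancel_left _ two_ne_zero, Int.toNat_of_nonneg (by linarith)]

theorem triNum_eq {z : ℤ} {n : ℕ} (h : z * (z + 1) = 2 * n) : triNum z = n := by
  have := two_mul_triNum z
  omega

theorem triNum_neg (z : ℤ) : triNum (-1 - z) = triNum z :=
  triNum_eq (by rw [two_mul_triNum]; ring)

theorem le_triNum {z : ℤ} {m : ℕ} (h : (m : ℤ) ≤ z ∨ z ≤ -1 - m) : m ≤ triNum z := by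
  have h1 := two_mul_triNum z
  have h2 : (m : ℤ) * (m + 1) ≤ z * (z + 1) := by
    rcases h with h | h <;> nlinarith [Int.natCast_nonneg m]
  have h3 : 2 * (m : ℤ) ≤ m * (m + 1) := by
    rcases Nat.eq_zero_or_pos m with rfl | hm
    · simp
    · have : (1 : ℤ) ≤ m := by exact_mod_cast hm
      nlinarith
  omega

/-! ### Gaussian binomials and the finite Jacobi triple product -/

section GaussBinom

variable {R : Type*} [CommRing R]

/-- The Gaussian binomial coefficients at `q`. -/
def gaussBinom (q : R) : ℕ → ℕ → R
  | _, 0 => 1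
  | 0, _ + 1 => 0
  | n + 1, k + 1 => gaussBinom q n k + q ^ (k + 1) * gaussBinom q n (k + 1)

@[simp] theorem gaussBinom_zero_right (q : R) (n : ℕ) : gaussBinom q n 0 = 1 := by
  cases n <;> rfl

theorem gaussBinom_succ_succ (q : R) (n k : ℕ) : gaussBinom q (n + 1) (k + 1) =
    gaussBinom q n k + q ^ (k + 1) * gaussBinom q n (k + 1) := rfl

theorem gaussBinom_eq_zero (q : R) {n k : ℕ} (h : n < k) : gaussBinom q n k = 0 := by
  induction n generalizing k with
  | zero => obtain ⟨k, rfl⟩ := Nat.exists_eq_succ_of_ne_zero h.ne'; rfl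
  | succ n ih =>
    obtain ⟨k, rfl⟩ := Nat.exists_eq_succ_of_ne_zero (Nat.ne_zero_of_lt h)
    rw [Nat.succ_eq_add_one, gaussBinom_succ_succ, ih (by omega), ih (by omega)]
    ring

/-- The finite product `(q; q)_n`. -/
def qPoch (q : R) (n : ℕ) : R := ∏ i ∈ Finset.range n, (1 - q ^ (i + 1))

@[simp] theorem qPoch_zero (q : R) : qPoch q 0 = 1 := rfl

theorem qPoch_succ (q : R) (n : ℕ) : qPoch q (n + 1) = qPoch q n * (1 - q ^ (n + 1)) :=
  Finset.prod_range_succ _ _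

theorem qPoch_mul_gaussBinom (q : R) (k l : ℕ) :
    qPoch q k * qPoch q l * gaussBinom q (k + l) k = qPoch q (k + l) := by
  induction hn : k + l generalizing k l with
  | zero =>
    obtain ⟨rfl, rfl⟩ : k = 0 ∧ l = 0 := by omega
    simp
  | succ n ih =>
    rcases k with _ | k
    · obtain rfl : l = n + 1 := by omega
      simp
    · rw [gaussBinom_succ_succ, qPoch_succ q n]
      have h1 := ih k l (by omega)
      rcases l with _ | l
      · obtain rfl : k = n := by omega
        rw [gaussBinom_eq_zero q (Nat.lt_succ_self k), qPoch_succ]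
        linear_combination (1 - q ^ (k + 1)) * h1
      · have h2 := ih (k + 1) l (by omega)
        have h3 : q ^ (n + 1) = q ^ (k + 1) * q ^ (l + 1) := by rw [← pow_add]; congr 1; omega
        rw [qPoch_succ] at h2 ⊢
        rw [h3]
        rw [qPoch_succ q l] at h1 ⊢
        linear_combination (1 - q ^ (k + 1)) * h1 + q ^ (k + 1) * (1 - q ^ (l + 1)) * h2

/-- The q-Pascal rule summed against arbitrary weights; it drives the inductions for both products
below. -/
theorem sum_gaussBinom_succ (q : R) (f : ℕ → R) (n : ℕ) :
    (∑ j ∈ Finset.range (n + 1), f j * q ^ j * gaussBinom q n j) +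
      ∑ j ∈ Finset.range (n + 1), f (j + 1) * gaussBinom q n j =
    ∑ j ∈ Finset.range (n + 2), f j * gaussBinom q (n + 1) j := by
  have h : ∑ j ∈ Finset.range (n + 1), f j * q ^ j * gaussBinom q n j =
      ∑ j ∈ Finset.range (n + 2), f j * q ^ j * gaussBinom q n j := by
    rw [Finset.sum_range_succ _ (n + 1), gaussBinom_eq_zero q (Nat.lt_succ_self n)]
    simp
  rw [h, Finset.sum_range_succ' _ (n + 1), Finset.sum_range_succ' _ (n + 1), add_right_comm,
    ← Finset.sum_add_distrib]
  congr 1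
  · refine Finset.sum_congr rfl fun j _ => ?_
    rw [gaussBinom_succ_succ]
    ring
  · simp

theorem prod_one_sub_mul_pow (q w : R) (n : ℕ) :
    ∏ i ∈ Finset.range n, (1 - w * q ^ i) =
      ∑ j ∈ Finset.range (n + 1), (-1) ^ j * q ^ triNum (-j) * w ^ j * gaussBinom q n j := by
  induction n generalizing w with
  | zero => simp [triNum]
  | succ n ih =>
    rw [Finset.prod_range_succ',
      ← sum_gaussBinom_succ q (fun j => (-1) ^ j * q ^ triNum (-j) * w ^ j) n]
    have h : ∀ i, 1 - w * q ^ (i + 1) = 1 - w * q * q ^ i := fun i => by ring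
    simp only [h, ih, pow_zero, mul_one, mul_sub, Finset.sum_mul]
    rw [sub_eq_add_neg, ← Finset.sum_neg_distrib]
    congr 1
    · exact Finset.sum_congr rfl fun j _ => by ring
    · refine Finset.sum_congr rfl fun j _ => ?_
      have : triNum (-((j + 1 : ℕ) : ℤ)) = triNum (-j) + j := by
        have := two_mul_triNum (-j)
        exact triNum_eq (by push_cast; linear_combination -this)
      rw [this]
      ring

/-- A finite form of the Jacobi triple product identity. -/
theorem prod_mul_prod_eq_sum_gaussBinom (q w : R) (a b : ℕ) :
    (∏ i ∈ Finset.range a, (q ^ (i + 1) - w)) * ∏ i ∈ Finset.range b, (1 - w * q ^ i) =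
      ∑ j ∈ Finset.range (a + b + 1),
        (-1) ^ j * q ^ triNum (a - j) * w ^ j * gaussBinom q (a + b) j := by
  induction a with
  | zero => simpa using prod_one_sub_mul_pow q w b
  | succ a ih =>
    rw [Finset.prod_range_succ, mul_right_comm, ih, add_right_comm a 1 b,
      ← sum_gaussBinom_succ q (fun j => (-1) ^ j * q ^ triNum ((a + 1 : ℕ) - j) * w ^ j),
      mul_sub, Finset.sum_mul, Finset.sum_mul, sub_eq_add_neg, ← Finset.sum_neg_distrib]
    congr 1
    · refine Finset.sum_congr rfl fun j _ => ?_
      have : triNum (a - j) + (a + 1) = triNum ((a + 1 : ℕ) - j) + j := by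
        have h1 := two_mul_triNum (a - j)
        have h2 := two_mul_triNum ((a + 1 : ℕ) - j)
        have h3 : 2 * ((triNum (a - j) : ℤ) + (a + 1)) = 2 * (triNum ((a + 1 : ℕ) - j) + j) := by
          push_cast at h2 ⊢
          linear_combination h1 - h2
        omega
      have := congrArg (q ^ ·) this
      simp only [pow_add q] at this
      linear_combination (-1) ^ j * w ^ j * gaussBinom q (a + b) j * this
    · refine Finset.sum_congr rfl fun j _ => ?_
      have : ((a + 1 : ℕ) : ℤ) - (j + 1 : ℕ) = a - j := by push_cast; ring
      rw [this]
      ring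

end GaussBinom

/-! ### Passing to the limit modulo powers of X -/

theorem eq_of_forall_X_pow_dvd {a b : ℤ⟦X⟧} (h : ∀ m : ℕ, X ^ m ∣ a - b) : a = b := by
  ext i
  have := X_pow_dvd_iff.mp (h (i + 1)) i (Nat.lt_succ_self i)
  rwa [map_sub, sub_eq_zero] at this

theorem coeff_qPoch_X_pow (a : ℕ) (ha : 1 ≤ a) {i n : ℕ} (h : i ≤ n) :
    coeff i (qPoch ((X : ℤ⟦X⟧) ^ a) n) = coeff i (qPoch ((X : ℤ⟦X⟧) ^ a) i) := by
  induction n, h using Nat.le_induction with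
  | base => rfl
  | succ n hn ih =>
    rw [qPoch_succ, mul_sub, mul_one, map_sub, ih, ← pow_mul, coeff_mul_X_pow', if_neg, sub_zero]
    nlinarith

theorem X_pow_dvd_fq_sub_qPoch (a : ℕ) (ha : 1 ≤ a) {m n : ℕ} (h : m ≤ n) :
    (X : ℤ⟦X⟧) ^ m ∣ fq a - qPoch (X ^ a) n := by
  rw [X_pow_dvd_iff]
  intro i hi
  have h1 : Filter.Tendsto (fun n => qPoch ((X : ℤ⟦X⟧) ^ a) n) Filter.atTop (nhds (fq a)) := by
    have := (fq_multipliable a ha).hasProd.tendsto_prod_nat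
    simp only [qPoch, ← pow_mul]
    exact this
  have h2 := ((PowerSeries.WithPiTopology.continuous_coeff ℤ i).tendsto (fq a)).comp h1
  have h3 : Filter.Tendsto (fun n => coeff i (qPoch ((X : ℤ⟦X⟧) ^ a) n)) Filter.atTop
      (nhds (coeff i (qPoch ((X : ℤ⟦X⟧) ^ a) i))) :=
    tendsto_atTop_of_eventually_const (i₀ := i) fun n hn => coeff_qPoch_X_pow a ha hn
  rw [map_sub, tendsto_nhds_unique h2 h3, coeff_qPoch_X_pow a ha (by omega : i ≤ n), sub_self]

theorem isUnit_fq (a : ℕ) (ha : 1 ≤ a) : IsUnit (fq a) := by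
  rw [isUnit_iff_constantCoeff, constantCoeff_fq a ha]
  exact isUnit_one

theorem fq_ne_zero (a : ℕ) (ha : 1 ≤ a) : fq a ≠ 0 := (isUnit_fq a ha).ne_zero

/-- Reduction modulo `X ^ m`. -/
noncomputable abbrev modX (m : ℕ) : ℤ⟦X⟧ →+* ℤ⟦X⟧ ⧸ Ideal.span {(X : ℤ⟦X⟧) ^ m} :=
  Ideal.Quotient.mk _

theorem modX_eq_iff {m : ℕ} {a b : ℤ⟦X⟧} : modX m a = modX m b ↔ X ^ m ∣ a - b := by
  rw [Ideal.Quotient.eq, Ideal.mem_span_singleton]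

theorem modX_qPoch (a : ℕ) (ha : 1 ≤ a) {m n : ℕ} (h : m ≤ n) :
    modX m (qPoch (X ^ a) n) = modX m (fq a) :=
  (modX_eq_iff.mpr (X_pow_dvd_fq_sub_qPoch a ha h)).symm

/-- All three finite products in `qPoch_mul_gaussBinom` agree with the unit `fq a` modulo X^m, and
one factor cancels. -/
theorem X_pow_dvd_fq_mul_gaussBinom (a : ℕ) (ha : 1 ≤ a) {m k l : ℕ} (hk : m ≤ k) (hl : m ≤ l) :
    (X : ℤ⟦X⟧) ^ m ∣ fq a * gaussBinom (X ^ a) (k + l) k - 1 := by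
  have h := congrArg (modX m) (qPoch_mul_gaussBinom ((X : ℤ⟦X⟧) ^ a) k l)
  rw [map_mul, map_mul, modX_qPoch a ha hk, modX_qPoch a ha hl, modX_qPoch a ha (by omega)] at h
  rw [← modX_eq_iff, map_mul, map_one]
  refine ((isUnit_fq a ha).map (modX m)).mul_left_cancel ?_
  linear_combination h

/-- Near either end of the range the weight c j vanishes modulo X^m; in the middle the Gaussian
binomial is the inverse of `fq a`. -/
theorem modX_fq_mul_sum_gaussBinom (a : ℕ) (ha : 1 ≤ a) {m N : ℕ}
    (c : ℕ → ℤ⟦X⟧) (h₁ : ∀ j < m, X ^ m ∣ c j) (h₂ : ∀ j, 2 * N + 1 < j + m → X ^ m ∣ c j) :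
    modX m (fq a * ∑ j ∈ Finset.range (2 * N + 2), c j * gaussBinom (X ^ a) (2 * N + 1) j) =
      modX m (∑ j ∈ Finset.range (2 * N + 2), c j) := by
  rw [modX_eq_iff, Finset.mul_sum, ← Finset.sum_sub_distrib]
  refine Finset.dvd_sum fun j hj => ?_
  have h : fq a * (c j * gaussBinom (X ^ a) (2 * N + 1) j) - c j =
      c j * (fq a * gaussBinom (X ^ a) (2 * N + 1) j - 1) := by ring
  rw [h]
  by_cases hj₁ : j < m
  · exact (h₁ j hj₁).mul_right _
  by_cases hj₂ : 2 * N + 1 < j + m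
  · exact (h₂ j hj₂).mul_right _
  · obtain ⟨l, hl⟩ := Nat.exists_eq_add_of_le (show j ≤ 2 * N + 1 by omega)
    rw [hl]
    exact (X_pow_dvd_fq_mul_gaussBinom a ha (by omega) (by omega)).mul_left _

theorem sum_range_two_mul_add_two {R : Type*} [AddCommMonoid R] (N : ℕ) (g : ℕ → R) :
    ∑ j ∈ Finset.range (2 * N + 2), g j =
      ∑ k ∈ Finset.range (N + 1), (g (N - k) + g (N + 1 + k)) := by
  rw [show 2 * N + 2 = (N + 1) + (N + 1) by ring, Finset.sum_range_add, Finset.sum_add_distrib,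
    ← Finset.sum_range_reflect]
  simp

/-- The power series `∑ k, c k * X ^ e k`, provided that `k ≤ e k`. -/
noncomputable def sparseSeries (e : ℕ → ℕ) (c : ℕ → ℤ) : ℤ⟦X⟧ :=
  .mk fun i => ∑ k ∈ Finset.range (i + 1), if e k = i then c k else 0

section SparseSeries

variable {e : ℕ → ℕ} {c : ℕ → ℤ}

theorem coeff_sparseSeries_of_notMem {i : ℕ} (h : ∀ k, e k ≠ i) :
    coeff i (sparseSeries e c) = 0 := by
  rw [sparseSeries, coeff_mk]
  exact Finset.sum_eq_zero fun k _ => if_neg (h k)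

theorem coeff_sparseSeries (he : StrictMono e) (k : ℕ) :
    coeff (e k) (sparseSeries e c) = c k := by
  rw [sparseSeries, coeff_mk, Finset.sum_eq_single k]
  · simp
  · intro l _ hl
    exact if_neg fun h => hl (he.injective h)
  · intro h
    exact absurd (Finset.mem_range.mpr (Nat.lt_succ_of_le (he.id_le k))) h

theorem modX_sum_eq_sparseSeries (he : StrictMono e) {m N : ℕ} (h : m ≤ N) :
    modX m (∑ k ∈ Finset.range (N + 1), (c k : ℤ⟦X⟧) * X ^ e k) = modX m (sparseSeries e c) := by
  rw [modX_eq_iff, X_pow_dvd_iff]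
  intro i hi
  rw [map_sub, sub_eq_zero, map_sum, sparseSeries, coeff_mk]
  have h1 : ∀ k, coeff i ((c k : ℤ⟦X⟧) * X ^ e k) = if e k = i then c k else 0 := by
    intro k
    rw [← map_intCast (C (R := ℤ)), coeff_C_mul, coeff_X_pow]
    simp [eq_comm]
  simp only [h1]
  symm
  refine Finset.sum_subset (Finset.range_mono (by omega)) fun k _ hk => if_neg ?_
  have := he.id_le k
  simp only [Finset.mem_range, id] at this hk
  omega

end SparseSeries

section Finite

variable {R : Type*} [CommRing R]

theorem map_gaussBinom {S : Type*} [CommRing S] (f : R →+* S) (q : R) (n k : ℕ) :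
    f (gaussBinom q n k) = gaussBinom (f q) n k := by
  induction n generalizing k with
  | zero => cases k <;> simp [gaussBinom]
  | succ n ih =>
    cases k with
    | zero => simp
    | succ k => simp [gaussBinom_succ_succ, ih]

/-- Differentiate the finite triple product in w at w = 1. The factor 1 - w vanishes there, so only
the term differentiating it survives. -/
theorem sum_natCast_mul_gaussBinom (q : R) (N : ℕ) :
    ∑ j ∈ Finset.range (2 * N + 2),
      (-1) ^ j * j * q ^ triNum (N - j) * gaussBinom q (2 * N + 1) j =
      (-1) ^ (N + 1) * qPoch q N ^ 2 := by
  have h := prod_mul_prod_eq_sum_gaussBinom (Polynomial.C q) Polynomial.X N (N + 1)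
  rw [Finset.prod_range_succ', ← mul_assoc] at h
  rw [show N + (N + 1) + 1 = 2 * N + 2 by ring, show N + (N + 1) = 2 * N + 1 by ring] at h
  have h1 : ∀ j : ℕ, (-1) ^ j * Polynomial.C q ^ triNum (N - j) * Polynomial.X ^ j *
      gaussBinom (Polynomial.C q) (2 * N + 1) j =
      Polynomial.C ((-1) ^ j * q ^ triNum (N - j) * gaussBinom q (2 * N + 1) j) *
        Polynomial.X ^ j := fun j => by
    simp only [map_mul, map_pow, map_neg, map_one, map_gaussBinom]
    ring
  simp only [h1] at h
  replace h := congrArg (fun p => Polynomial.eval 1 (Polynomial.derivative p)) h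
  rw [Polynomial.derivative_mul] at h
  simp only [Polynomial.derivative_sum, Polynomial.eval_finsetSum, Polynomial.derivative_C,
    Polynomial.derivative_X_pow, Polynomial.eval_add, Polynomial.eval_mul, Polynomial.eval_prod,
    Polynomial.eval_sub, Polynomial.eval_pow, Polynomial.eval_C, Polynomial.eval_X,
    Polynomial.eval_one, Polynomial.derivative_sub, Polynomial.derivative_mul,
    Polynomial.derivative_one, Polynomial.derivative_X, pow_zero, one_pow, mul_one, one_mul,
    sub_self, mul_zero, zero_mul, zero_add, zero_sub, Polynomial.eval_neg] at h
  have h2 : ∏ i ∈ Finset.range N, (q ^ (i + 1) - 1) = (-1) ^ N * qPoch q N := by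
    have : ∀ i, q ^ (i + 1) - 1 = -1 * (1 - q ^ (i + 1)) := fun i => by ring
    simp only [this, Finset.prod_mul_distrib, Finset.prod_const, Finset.card_range, qPoch]
  rw [h2, ← qPoch] at h
  rw [pow_succ, sq, ← mul_assoc]
  refine Eq.trans (Finset.sum_congr rfl fun j _ => ?_) (h.symm.trans ?_) <;> ring

end Finite
theorem strictMono_triNum : StrictMono fun k : ℕ => triNum k := by
  refine strictMono_nat_of_lt_succ fun k => ?_
  have h1 := two_mul_triNum k
  have h2 := two_mul_triNum (k + 1 : ℕ)
  push_cast at h2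
  have : (triNum k : ℤ) < triNum (k + 1 : ℕ) := by push_cast; nlinarith
  exact_mod_cast this

theorem triNum_lower {N k : ℕ} (h : k ≤ N) : triNum ((N : ℤ) - (N - k : ℕ)) = triNum k := by
  congr 1
  omega

theorem triNum_upper (N k : ℕ) : triNum ((N : ℤ) - (N + 1 + k : ℕ)) = triNum k := by
  rw [← triNum_neg k]
  congr 1
  omega

theorem X_pow_dvd_X_pow_triNum {z : ℤ} {m : ℕ} (h : (m : ℤ) ≤ z ∨ z ≤ -1 - m) :
    (X : ℤ⟦X⟧) ^ m ∣ X ^ triNum z :=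
  pow_dvd_pow _ (le_triNum h)

theorem expand_fq (p : ℕ) (hp : p ≠ 0) (a : ℕ) (ha : 1 ≤ a) :
    expand p hp (fq a) = fq (p * a) := by
  refine eq_of_forall_X_pow_dvd fun m => ?_
  have h := X_pow_dvd_fq_sub_qPoch a ha le_rfl (m := m)
  have h1 : expand p hp (qPoch ((X : ℤ⟦X⟧) ^ a) m) = qPoch (X ^ (p * a)) m := by
    simp [qPoch, map_prod, ← pow_mul, mul_assoc]
  have h2 : (X : ℤ⟦X⟧) ^ m ∣ expand p hp (fq a) - qPoch (X ^ (p * a)) m := by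
    rw [← h1, ← map_sub]
    refine dvd_trans ?_ (map_dvd (expand p hp) h)
    rw [map_pow, expand_X, ← pow_mul]
    exact pow_dvd_pow _ (Nat.le_mul_of_pos_left m (Nat.pos_of_ne_zero hp))
  have h3 := X_pow_dvd_fq_sub_qPoch (p * a) (Nat.mul_pos (Nat.pos_of_ne_zero hp) ha)
    le_rfl (m := m)
  rw [← sub_sub_sub_cancel_right _ _ (qPoch (X ^ (p * a)) m)]
  exact dvd_sub h2 h3

/-- The power series `∑ k, (-1) ^ k * (2 * k + 1) * X ^ (k * (k + 1) / 2)`. -/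
noncomputable def jacobiSeries : ℤ⟦X⟧ :=
  sparseSeries (fun k => triNum k) fun k => (-1) ^ k * (2 * k + 1)

/-- The power series `∑ k, X ^ (k * (k + 1) / 2)`. -/
noncomputable def psiSeries : ℤ⟦X⟧ := sparseSeries (fun k => triNum k) fun _ => 1

/-- The power series `1 + 2 * ∑ k ≥ 1, (-1) ^ k * X ^ (k ^ 2)`. -/
noncomputable def phiSeries : ℤ⟦X⟧ := 2 * sparseSeries (fun k => k ^ 2) (fun k => (-1) ^ k) - 1

/-! ### Theta expansions of f_1^3, f_2^2/f_1 and f_1^2/f_2 -/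

theorem neg_one_pow_sub {R : Type*} [CommRing R] {N k : ℕ} (h : k ≤ N) :
    (-1 : R) ^ (N - k) = (-1) ^ N * (-1) ^ k := by
  obtain ⟨l, rfl⟩ := Nat.exists_eq_add_of_le h
  rw [Nat.add_sub_cancel_left, pow_add]
  have : (-1 : R) ^ k * (-1) ^ k = 1 := by rw [← mul_pow]; simp
  linear_combination -(-1) ^ l * this

theorem fq_one_pow_three : fq 1 ^ 3 = jacobiSeries := by
  refine eq_of_forall_X_pow_dvd fun m => modX_eq_iff.mp ?_
  -- With N = 2m, every index within m of an end has |N - j| large enough for its triangular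
  -- exponent to be at least m.
  set N := 2 * m
  have h := modX_fq_mul_sum_gaussBinom 1 le_rfl (m := m) (N := N)
    (fun j => (-1) ^ j * (j : ℤ⟦X⟧) * (X ^ 1) ^ triNum (N - j))
    (fun j hj => Dvd.dvd.mul_left (by
      rw [pow_one]; exact X_pow_dvd_X_pow_triNum (Or.inl (by omega))) _)
    (fun j hj => Dvd.dvd.mul_left (by
      rw [pow_one]; exact X_pow_dvd_X_pow_triNum (Or.inr (by omega))) _)
  rw [sum_natCast_mul_gaussBinom, sum_range_two_mul_add_two] at h
  have h1 : ∑ k ∈ Finset.range (N + 1),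
      ((-1) ^ (N - k) * ((N - k : ℕ) : ℤ⟦X⟧) * (X ^ 1) ^ triNum ((N : ℤ) - (N - k : ℕ)) +
        (-1) ^ (N + 1 + k) * ((N + 1 + k : ℕ) : ℤ⟦X⟧) *
          (X ^ 1) ^ triNum ((N : ℤ) - (N + 1 + k : ℕ))) =
      (-1) ^ (N + 1) * ∑ k ∈ Finset.range (N + 1),
        (((-1) ^ k * (2 * k + 1) : ℤ) : ℤ⟦X⟧) * X ^ triNum k := by
    rw [Finset.mul_sum]
    refine Finset.sum_congr rfl fun k hk => ?_
    have hk' : k ≤ N := Nat.lt_succ_iff.mp (Finset.mem_range.mp hk)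
    rw [triNum_lower hk', triNum_upper, neg_one_pow_sub hk', Nat.cast_sub hk']
    push_cast
    ring
  rw [h1, map_mul, map_mul, map_mul (modX m) (_ ^ _) (Finset.sum _ _), map_pow (modX m) (qPoch _ _),
    modX_qPoch 1 le_rfl (by omega), modX_sum_eq_sparseSeries strictMono_triNum (by omega)] at h
  have h2 : (modX m) ((-1) ^ (N + 1)) * (modX m) ((-1) ^ (N + 1)) = 1 := by
    rw [← map_mul, ← mul_pow]; simp
  rw [jacobiSeries, map_pow]
  linear_combination (modX m) ((-1) ^ (N + 1)) * h +
    (modX m (sparseSeries _ _) - modX m (fq 1) ^ 3) * h2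

theorem qPoch_mul_prod_one_add {R : Type*} [CommRing R] (q : R) (N : ℕ) :
    qPoch q N * ∏ i ∈ Finset.range N, (1 + q ^ (i + 1)) = qPoch (q ^ 2) N := by
  rw [qPoch, qPoch, ← Finset.prod_mul_distrib]
  exact Finset.prod_congr rfl fun i _ => by ring

theorem fq_two_pow_two : fq 2 ^ 2 = fq 1 * psiSeries := by
  refine mul_left_cancel₀ (fq_ne_zero 1 le_rfl) (eq_of_forall_X_pow_dvd fun m => ?_)
  set N := 2 * m
  have h := modX_fq_mul_sum_gaussBinom 1 le_rfl (m := m) (N := N)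
    (fun j => (-1) ^ j * (X ^ 1) ^ triNum (N - j) * (-1) ^ j)
    (fun j hj => Dvd.dvd.mul_right (Dvd.dvd.mul_left (by
      rw [pow_one]; exact X_pow_dvd_X_pow_triNum (Or.inl (by omega))) _) _)
    (fun j hj => Dvd.dvd.mul_right (Dvd.dvd.mul_left (by
      rw [pow_one]; exact X_pow_dvd_X_pow_triNum (Or.inr (by omega))) _) _)
  have h0 := prod_mul_prod_eq_sum_gaussBinom ((X : ℤ⟦X⟧) ^ 1) (-1) N (N + 1)
  rw [show N + (N + 1) + 1 = 2 * N + 2 by ring, show N + (N + 1) = 2 * N + 1 by ring] at h0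
  rw [← h0, sum_range_two_mul_add_two] at h
  have h1 : ∀ j : ℕ, (-1 : ℤ⟦X⟧) ^ j * (-1) ^ j = 1 := fun j => by rw [← mul_pow]; simp
  have h2 : ∑ k ∈ Finset.range (N + 1),
      ((-1 : ℤ⟦X⟧) ^ (N - k) * (X ^ 1) ^ triNum ((N : ℤ) - (N - k : ℕ)) * (-1) ^ (N - k) +
        (-1) ^ (N + 1 + k) * (X ^ 1) ^ triNum ((N : ℤ) - (N + 1 + k : ℕ)) * (-1) ^ (N + 1 + k)) =
      2 * ∑ k ∈ Finset.range (N + 1), ((1 : ℤ) : ℤ⟦X⟧) * X ^ triNum k := by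
    rw [Finset.mul_sum]
    refine Finset.sum_congr rfl fun k hk => ?_
    rw [triNum_lower (Nat.lt_succ_iff.mp (Finset.mem_range.mp hk)), triNum_upper]
    push_cast
    linear_combination X ^ triNum k * (h1 (N - k) + h1 (N + 1 + k))
  have h3 : (∏ i ∈ Finset.range N, (((X : ℤ⟦X⟧) ^ 1) ^ (i + 1) - -1)) *
      ∏ i ∈ Finset.range (N + 1), (1 - -1 * (X ^ 1) ^ i) =
      2 * (∏ i ∈ Finset.range N, (1 + ((X : ℤ⟦X⟧) ^ 1) ^ (i + 1))) ^ 2 := by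
    rw [Finset.prod_range_succ', sq, ← mul_assoc, ← mul_assoc]
    have : ∀ i, ((X : ℤ⟦X⟧) ^ 1) ^ (i + 1) - -1 = 1 + (X ^ 1) ^ (i + 1) := fun i => by ring
    simp only [this, neg_mul, one_mul, sub_neg_eq_add]
    ring
  rw [h2, h3, modX_eq_iff] at h
  -- At w = -1 both sides carry a factor 2; it is cancelled coefficientwise over ℤ, since 2 is not a
  -- unit.
  have h4 : (X : ℤ⟦X⟧) ^ m ∣ fq 1 * (∏ i ∈ Finset.range N, (1 + ((X : ℤ⟦X⟧) ^ 1) ^ (i + 1))) ^ 2 -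
      ∑ k ∈ Finset.range (N + 1), ((1 : ℤ) : ℤ⟦X⟧) * X ^ triNum k := by
    rw [X_pow_dvd_iff] at h ⊢
    intro i hi
    have := h i hi
    rw [mul_left_comm, ← mul_sub, ← map_ofNat (C (R := ℤ)), coeff_C_mul] at this
    simpa using this
  have h5 := congrArg (modX m) (qPoch_mul_prod_one_add ((X : ℤ⟦X⟧) ^ 1) N)
  rw [← pow_mul, one_mul, map_mul, modX_qPoch 1 le_rfl (by omega),
    modX_qPoch 2 (by norm_num) (by omega)] at h5
  rw [← modX_eq_iff, modX_sum_eq_sparseSeries strictMono_triNum (by omega), map_mul, map_pow] at h4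
  rw [← modX_eq_iff, psiSeries]
  simp only [map_mul, map_pow, ← h5]
  linear_combination modX m (fq 1) ^ 2 * h4

theorem prod_one_sub_pow_odd_mul_qPoch {R : Type*} [CommRing R] (q : R) (n : ℕ) :
    (∏ i ∈ Finset.range n, (1 - q ^ (2 * i + 1))) * qPoch (q ^ 2) n = qPoch q (2 * n) := by
  induction n with
  | zero => simp
  | succ n ih =>
    rw [Finset.prod_range_succ, qPoch_succ, show 2 * (n + 1) = 2 * n + 1 + 1 by ring, qPoch_succ,
      qPoch_succ, ← ih]
    ring

theorem fq_one_pow_two : fq 1 ^ 2 = fq 2 * phiSeries := by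
  refine mul_left_cancel₀ (fq_ne_zero 2 (by norm_num)) (eq_of_forall_X_pow_dvd fun m => ?_)
  set N := 2 * m with hN
  have h0 : (-1) ^ N * ((∏ i ∈ Finset.range N, (1 - (X : ℤ⟦X⟧) ^ (2 * i + 1))) *
      ∏ i ∈ Finset.range (N + 1), (1 - (X : ℤ⟦X⟧) ^ (2 * i + 1))) =
      ∑ j ∈ Finset.range (2 * N + 2), (-1) ^ j * X ^ ((N - j : ℤ).natAbs ^ 2) *
        gaussBinom ((X : ℤ⟦X⟧) ^ 2) (2 * N + 1) j := by
    have h := prod_mul_prod_eq_sum_gaussBinom ((X : ℤ⟦X⟧) ^ 2) X N (N + 1)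
    rw [show N + (N + 1) + 1 = 2 * N + 2 by ring, show N + (N + 1) = 2 * N + 1 by ring] at h
    -- The triple product at base X² and w = X carries an extra X^N, one X from each factor X^(2i+2)
    -- - X.
    refine mul_left_cancel₀ (pow_ne_zero N (X_ne_zero (R := ℤ))) ?_
    rw [Finset.mul_sum]
    convert h using 1
    · have h1 : ∀ i, ((X : ℤ⟦X⟧) ^ 2) ^ (i + 1) - X = -X * (1 - X ^ (2 * i + 1)) := fun i => by ring
      have h2 : ∀ i, (X : ℤ⟦X⟧) * (X ^ 2) ^ i = X ^ (2 * i + 1) := fun i => by ring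
      simp only [h1, h2, Finset.prod_mul_distrib, Finset.prod_const, Finset.card_range,
        neg_pow (X : ℤ⟦X⟧) N]
      ring
    · refine Finset.sum_congr rfl fun j _ => ?_
      have : N + (N - j : ℤ).natAbs ^ 2 = 2 * triNum (N - j) + j := by
        have := two_mul_triNum (N - j)
        zify
        rw [sq_abs, this]
        ring
      have := congrArg ((X : ℤ⟦X⟧) ^ ·) this
      simp only [pow_add, pow_mul (X : ℤ⟦X⟧) 2] at this
      linear_combination (-1) ^ j * gaussBinom ((X : ℤ⟦X⟧) ^ 2) (2 * N + 1) j * this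
  have hsq : ∀ j : ℕ, m ≤ (N - j : ℤ).natAbs →
      (X : ℤ⟦X⟧) ^ m ∣ (-1) ^ j * X ^ ((N - j : ℤ).natAbs ^ 2) := fun j hj => by
    refine Dvd.dvd.mul_left (pow_dvd_pow _ ?_) _
    exact hj.trans (Nat.le_self_pow two_ne_zero _)
  have h := modX_fq_mul_sum_gaussBinom 2 (by norm_num) (m := m) (N := N)
    (fun j => (-1) ^ j * X ^ ((N - j : ℤ).natAbs ^ 2))
    (fun j hj => hsq j (by omega)) (fun j hj => hsq j (by omega))
  rw [← h0, sum_range_two_mul_add_two] at h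
  -- Each square from 1 to n² occurs in two adjacent pairs with the same sign, 0 occurs once, and
  -- (n+1)² is left as a boundary term.
  have h1 : ∀ n ≤ N, ∑ k ∈ Finset.range (n + 1),
      ((-1 : ℤ⟦X⟧) ^ (N - k) * X ^ (((N : ℤ) - (N - k : ℕ)).natAbs ^ 2) +
        (-1) ^ (N + 1 + k) * X ^ (((N : ℤ) - (N + 1 + k : ℕ)).natAbs ^ 2)) =
      (-1) ^ N * (2 * ∑ k ∈ Finset.range (n + 1), (((-1) ^ k : ℤ) : ℤ⟦X⟧) * X ^ k ^ 2 - 1 +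
        (-1) ^ (n + 1) * X ^ (n + 1) ^ 2) := by
    intro n hn
    have h2 : ∀ k ≤ N, ((-1 : ℤ⟦X⟧) ^ (N - k) * X ^ (((N : ℤ) - (N - k : ℕ)).natAbs ^ 2) +
        (-1) ^ (N + 1 + k) * X ^ (((N : ℤ) - (N + 1 + k : ℕ)).natAbs ^ 2)) =
        (-1) ^ N * (-1) ^ k * (X ^ k ^ 2 - X ^ (k + 1) ^ 2) := by
      intro k hk
      rw [neg_one_pow_sub hk, show ((N : ℤ) - (N - k : ℕ)).natAbs = k by omega,
        show ((N : ℤ) - (N + 1 + k : ℕ)).natAbs = k + 1 by omega]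
      ring
    induction n with
    | zero =>
      rw [Finset.sum_range_one, Finset.sum_range_one, h2 0 hn]
      push_cast
      ring
    | succ n ih =>
      rw [Finset.sum_range_succ, ih (by omega), h2 _ hn, Finset.sum_range_succ _ (n + 1)]
      push_cast
      ring
  have h2 : modX m (X ^ (N + 1) ^ 2) = 0 := by
    rw [Ideal.Quotient.eq_zero_iff_mem, Ideal.mem_span_singleton]
    exact pow_dvd_pow _ (by nlinarith)
  have h3 : (modX m) ((-1) ^ N) * (modX m) ((-1) ^ N) = 1 := by
    rw [← map_mul, ← mul_pow]; simp
  have h4 := congrArg (modX m) (prod_one_sub_pow_odd_mul_qPoch (X : ℤ⟦X⟧) N)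
  have h5 := congrArg (modX m) (prod_one_sub_pow_odd_mul_qPoch (X : ℤ⟦X⟧) (N + 1))
  have h6 : ∀ n, m ≤ n → modX m (qPoch X n) = modX m (fq 1) := fun n hn => by
    simpa using modX_qPoch 1 le_rfl hn
  rw [map_mul, h6 _ (by omega), modX_qPoch 2 (by norm_num) (by omega)] at h4 h5
  rw [h1 N le_rfl] at h
  simp only [map_mul, map_add, map_sub, h2, modX_sum_eq_sparseSeries
    (show StrictMono fun k : ℕ => k ^ 2 from Nat.pow_left_strictMono two_ne_zero)
    (show m ≤ N by omega)] at h
  rw [← modX_eq_iff, phiSeries]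
  simp only [map_mul, map_pow, map_sub]
  set f := modX m (fq 2)
  set a := modX m (fq 1)
  set s := modX m ((-1) ^ N)
  set O := modX m (∏ i ∈ Finset.range N, (1 - (X : ℤ⟦X⟧) ^ (2 * i + 1)))
  set P := modX m (∏ i ∈ Finset.range (N + 1), (1 - (X : ℤ⟦X⟧) ^ (2 * i + 1)))
  set S := modX m 2 * modX m (sparseSeries (fun k => k ^ 2) fun k => (-1) ^ k) - modX m 1
  linear_combination -f * P * f * h4 - f * a * h5 + f ^ 2 * s * h - f ^ 2 * (f * O * P - S) * h3

/-! ### Dissection of power series modulo 5 -/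

/-- On the residue class of r, P and Q may be replaced by c q^a P(q^25) and d q^b Q(q^25); the
product is cd q^(5e+r) (PQ)(q^25). -/
theorem coeff_mul_eq_of_sieve {P Q : ℤ⟦X⟧} {a b e r : ℕ} {c d : ℤ} (hr : a + b = 5 * e + r)
    (h₁ : ∀ i j, (i + j) % 5 = r % 5 → coeff i P ≠ 0 → coeff j Q ≠ 0 →
      (∃ i', i = 25 * i' + a) ∧ ∃ j', j = 25 * j' + b)
    (hP : ∀ i, coeff (25 * i + a) P = c * coeff i P)
    (hQ : ∀ i, coeff (25 * i + b) Q = d * coeff i Q) (n : ℕ) :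
    coeff (5 * n + r) (P * Q) =
      c * d * coeff n (X ^ e * expand 5 (by norm_num) (P * Q)) := by
  have hdil : ∀ (a : ℕ) (c : ℤ) (P : ℤ⟦X⟧), (∀ i, coeff (25 * i + a) P = c * coeff i P) →
      (∀ i, coeff (25 * i + a) P =
        coeff (25 * i + a) (C c * (expand 25 (by norm_num) P * X ^ a))) ∧
      ∀ i, (¬ ∃ i', i = 25 * i' + a) →
        coeff i (C c * (expand 25 (by norm_num) P * X ^ a)) = 0 := by
    refine fun a c P h => ⟨fun i => ?_, fun i hi => ?_⟩
    · rw [h, coeff_C_mul, coeff_mul_X_pow, coeff_expand_mul]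
    · rw [coeff_C_mul, coeff_mul_X_pow']
      split_ifs with hai
      · rw [coeff_expand_of_not_dvd, mul_zero]
        rintro ⟨k, hk⟩
        exact hi ⟨k, by omega⟩
      · simp
  obtain ⟨hP₁, hP₂⟩ := hdil a c P hP
  obtain ⟨hQ₁, hQ₂⟩ := hdil b d Q hQ
  have h : coeff (5 * n + r) (P * Q) = coeff (5 * n + r)
      ((C c * (expand 25 (by norm_num) P * X ^ a)) *
        (C d * (expand 25 (by norm_num) Q * X ^ b))) := by
    rw [coeff_mul, coeff_mul]
    refine Finset.sum_congr rfl fun ⟨i, j⟩ hij => ?_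
    rw [Finset.HasAntidiagonal.mem_antidiagonal] at hij
    dsimp only at hij ⊢
    by_cases hi : ∃ i', i = 25 * i' + a
    · by_cases hj : ∃ j', j = 25 * j' + b
      · obtain ⟨i, rfl⟩ := hi
        obtain ⟨j, rfl⟩ := hj
        rw [hP₁, hQ₁]
      · rw [hQ₂ j hj, mul_zero]
        by_contra h0
        exact hj (h₁ i j (by omega) (left_ne_zero_of_mul h0) (right_ne_zero_of_mul h0)).2
    · rw [hP₂ i hi, zero_mul]
      by_contra h0
      exact hi (h₁ i j (by omega) (left_ne_zero_of_mul h0) (right_ne_zero_of_mul h0)).1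
  have h' : (C c * (expand 25 (by norm_num) P * X ^ a)) *
      (C d * (expand 25 (by norm_num) Q * X ^ b)) =
      C (c * d) * (expand 5 (by norm_num) (X ^ e * expand 5 (by norm_num) (P * Q)) * X ^ r) := by
    rw [map_mul (expand 5 _) (X ^ e), map_pow, expand_X, ← expand_mul, map_mul (C (R := ℤ)),
      map_mul (expand (5 * 5) _), ← pow_mul]
    have : (X : ℤ⟦X⟧) ^ a * X ^ b = X ^ (5 * e) * X ^ r := by rw [← pow_add, hr, pow_add]
    linear_combination C c * C d * expand 25 (by norm_num) P * expand 25 (by norm_num) Q * this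
  rw [h, h', coeff_C_mul, coeff_mul_X_pow, coeff_expand_mul]

theorem coeff_expand_mul_left (A B : ℤ⟦X⟧) {p : ℕ} (hp : p ≠ 0) (n : ℕ) {r : ℕ} (hr : r < p) :
    coeff (p * n + r) (expand p hp A * B) =
      coeff n (A * .mk fun k => coeff (p * k + r) B) := by
  rw [coeff_mul, coeff_mul]
  have hp' := Nat.pos_of_ne_zero hp
  refine (Finset.sum_of_injOn (fun x => (p * x.1, p * x.2 + r)) ?_ ?_ ?_ ?_).symm
  · rintro ⟨i, j⟩ _ ⟨i', j'⟩ _ h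
    simpa [hp] using h
  · rintro ⟨i, j⟩ h
    simp only [Finset.mem_coe,
      Finset.HasAntidiagonal.mem_antidiagonal] at h ⊢
    rw [← h]
    ring
  · rintro ⟨i, j⟩ h h'
    rw [Finset.HasAntidiagonal.mem_antidiagonal] at h
    dsimp only at h ⊢
    rw [coeff_expand_of_not_dvd, zero_mul]
    rintro ⟨k, rfl⟩
    refine h' ⟨(k, n - k), ?_, ?_⟩
    · have : k ≤ n := by
        by_contra hk
        have : p * (n + 1) ≤ p * k := Nat.mul_le_mul_left p (by omega)
        rw [mul_add] at this
        omega
      simp [this]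
    · have : k ≤ n := by
        by_contra hk
        have : p * (n + 1) ≤ p * k := Nat.mul_le_mul_left p (by omega)
        rw [mul_add] at this
        omega
      obtain ⟨l, rfl⟩ := Nat.exists_eq_add_of_le this
      simp only [Nat.add_sub_cancel_left, Prod.mk.injEq, true_and]
      rw [mul_add] at h
      omega
  · rintro ⟨i, j⟩ _
    simp [coeff_expand_mul]

/-! ### Residues of squares and triangular numbers -/

theorem exists_of_coeff_sparseSeries_ne_zero {e : ℕ → ℕ} {c : ℕ → ℤ} {i : ℕ}
    (h : coeff i (sparseSeries e c) ≠ 0) : ∃ k, e k = i := by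
  by_contra! h'
  exact h (coeff_sparseSeries_of_notMem h')

theorem triNum_five_mul_add_two (k : ℕ) : triNum (5 * k + 2 : ℕ) = 25 * triNum k + 3 :=
  triNum_eq (by have := two_mul_triNum k; push_cast; linear_combination -25 * this)

theorem mod_five_of_triNum {k i : ℕ} (h : triNum k = 25 * i + 3) : k % 5 = 2 := by
  have h1 := two_mul_triNum k
  rw [h] at h1
  have h2 : (k * (k + 1)) % 5 = 1 := by
    zify
    rw [← h1]
    push_cast
    omega
  have h3 : k % 5 < 5 := Nat.mod_lt _ (by norm_num)
  rw [Nat.mul_mod, Nat.add_mod] at h2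
  interval_cases k % 5 <;> simp_all

theorem coeff_sparseSeries_triNum {c : ℕ → ℤ} {d : ℤ} (hc : ∀ k, c (5 * k + 2) = d * c k)
    (i : ℕ) : coeff (25 * i + 3) (sparseSeries (fun k => triNum k) c) =
      d * coeff i (sparseSeries (fun k => triNum k) c) := by
  by_cases h : ∃ k : ℕ, triNum k = i
  · obtain ⟨k, rfl⟩ := h
    rw [← triNum_five_mul_add_two]
    have h1 := coeff_sparseSeries (c := c) strictMono_triNum
    rw [h1 (5 * k + 2), h1 k, hc]
  · rw [coeff_sparseSeries_of_notMem (fun k hk => h ⟨k, hk⟩), coeff_sparseSeries_of_notMem,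
      mul_zero]
    intro k hk
    have hk' := mod_five_of_triNum hk
    obtain ⟨l, rfl⟩ : ∃ l, k = 5 * l + 2 := ⟨k / 5, by omega⟩
    rw [triNum_five_mul_add_two] at hk
    exact h ⟨l, by omega⟩

theorem coeff_jacobiSeries (i : ℕ) :
    coeff (25 * i + 3) jacobiSeries = 5 * coeff i jacobiSeries :=
  coeff_sparseSeries_triNum (fun k => by
    have : (-1 : ℤ) ^ (5 * k + 2) = (-1) ^ k := by
      rw [pow_add, pow_mul]; norm_num
    rw [this]; push_cast; ring) i

theorem coeff_psiSeries (i : ℕ) : coeff (25 * i + 3) psiSeries = 1 * coeff i psiSeries :=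
  coeff_sparseSeries_triNum (fun _ => by norm_num) i

theorem coeff_expand_two_jacobiSeries (i : ℕ) :
    coeff (25 * i + 6) (expand 2 two_ne_zero jacobiSeries) =
      5 * coeff i (expand 2 two_ne_zero jacobiSeries) := by
  by_cases h : 2 ∣ i
  · obtain ⟨i, rfl⟩ := h
    rw [coeff_expand_mul, show 25 * (2 * i) + 6 = 2 * (25 * i + 3) by ring, coeff_expand_mul,
      coeff_jacobiSeries]
  · rw [coeff_expand_of_not_dvd _ _ _ h, coeff_expand_of_not_dvd _ _ _ (by omega), mul_zero]

theorem coeff_phiSeries (i : ℕ) : coeff (25 * i + 0) phiSeries = 1 * coeff i phiSeries := by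
  have hm : StrictMono fun k : ℕ => k ^ 2 := Nat.pow_left_strictMono two_ne_zero
  have h : coeff (25 * i) (sparseSeries (fun k => k ^ 2) fun k => (-1) ^ k) =
      coeff i (sparseSeries (fun k => k ^ 2) fun k => (-1) ^ k) := by
    by_cases h : ∃ k : ℕ, k ^ 2 = i
    · obtain ⟨k, rfl⟩ := h
      have h1 := coeff_sparseSeries (c := fun k => (-1) ^ k) hm
      rw [show 25 * k ^ 2 = (5 * k) ^ 2 by ring, h1 (5 * k), h1 k, pow_mul]
      norm_num
    · rw [coeff_sparseSeries_of_notMem (fun k hk => h ⟨k, hk⟩), coeff_sparseSeries_of_notMem]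
      intro k hk
      obtain ⟨l, rfl⟩ : 5 ∣ k := (show Nat.Prime 5 by norm_num).dvd_of_dvd_pow (n := 2) (by omega)
      exact h ⟨l, by rw [mul_pow] at hk; omega⟩
  rw [phiSeries, map_sub, map_sub, ← map_ofNat (C (R := ℤ)), coeff_C_mul, coeff_C_mul, add_zero,
    h, one_mul, coeff_one, coeff_one]
  simp

theorem exists_of_coeff_phiSeries_ne_zero {i : ℕ} (h : coeff i phiSeries ≠ 0) :
    ∃ k, k ^ 2 = i := by
  by_contra! h'
  apply h
  rw [phiSeries, map_sub, ← map_ofNat (C (R := ℤ)), coeff_C_mul, coeff_sparseSeries_of_notMem h',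
    coeff_one, if_neg (fun hi => h' 0 (by simp [hi]))]
  simp

theorem two_mul_triNum_nat (k : ℕ) : 2 * triNum k = k * (k + 1) := by
  exact_mod_cast two_mul_triNum k

theorem triNum_mod_five (k : ℕ) : (k % 5 = 2 ∧ ∃ i, triNum k = 25 * i + 3) ∨
    triNum k % 5 = 0 ∨ triNum k % 5 = 1 := by
  have h : k % 5 < 5 := Nat.mod_lt _ (by norm_num)
  have h1 := two_mul_triNum_nat k
  have h2 : (2 * triNum k) % 5 = ((k % 5) * ((k % 5 + 1) % 5)) % 5 := by
    rw [h1, Nat.mul_mod, Nat.add_mod]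
  by_cases hk : k % 5 = 2
  · left
    obtain ⟨l, rfl⟩ : ∃ l, k = 5 * l + 2 := ⟨k / 5, by omega⟩
    exact ⟨hk, _, triNum_five_mul_add_two l⟩
  · right
    interval_cases k % 5 <;> omega

theorem sq_mod_five (k : ℕ) : (∃ i, k ^ 2 = 25 * i) ∨ k ^ 2 % 5 = 1 ∨ k ^ 2 % 5 = 4 := by
  have h : k % 5 < 5 := Nat.mod_lt _ (by norm_num)
  by_cases hk : k % 5 = 0
  · left
    obtain ⟨l, rfl⟩ : ∃ l, k = 5 * l := ⟨k / 5, by omega⟩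
    exact ⟨l ^ 2, by ring⟩
  · right
    rw [Nat.pow_mod]
    interval_cases k % 5 <;> simp_all

/-- The power series `f_1 ^ 5 / f_2`. -/
noncomputable def phiJacobi : ℤ⟦X⟧ := phiSeries * jacobiSeries

/-- The power series `f_2 ^ 5 / f_1`. -/
noncomputable def psiJacobi : ℤ⟦X⟧ := psiSeries * expand 2 two_ne_zero jacobiSeries

/-! ### The two dissections and the recursion for M -/

theorem fq_two_mul_phiJacobi : fq 2 * phiJacobi = fq 1 ^ 5 := by
  rw [phiJacobi, ← mul_assoc, ← fq_one_pow_two, ← fq_one_pow_three, ← pow_add]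

theorem fq_one_mul_psiJacobi : fq 1 * psiJacobi = fq 2 ^ 5 := by
  rw [psiJacobi, ← mul_assoc, ← fq_two_pow_two, ← fq_one_pow_three, map_pow,
    expand_fq 2 two_ne_zero 1 le_rfl, ← pow_add]

theorem coeff_phiJacobi (n : ℕ) :
    coeff (5 * n + 3) phiJacobi = 5 * coeff n (expand 5 (by norm_num) phiJacobi) := by
  have := coeff_mul_eq_of_sieve (e := 0) (r := 3) (by norm_num) ?_ coeff_phiSeries
    coeff_jacobiSeries n
  · simpa [phiJacobi] using this
  · intro i j hij hi hj
    obtain ⟨k, rfl⟩ := exists_of_coeff_phiSeries_ne_zero hi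
    obtain ⟨l, rfl⟩ := exists_of_coeff_sparseSeries_ne_zero hj
    rcases sq_mod_five k with ⟨i, h⟩ | h <;> rcases triNum_mod_five l with ⟨-, j, h'⟩ | h'
    · exact ⟨⟨i, h⟩, j, h'⟩
    all_goals omega

theorem coeff_psiJacobi (n : ℕ) :
    coeff (5 * n + 4) psiJacobi = 5 * coeff n (X * expand 5 (by norm_num) psiJacobi) := by
  have := coeff_mul_eq_of_sieve (e := 1) (r := 4) (by norm_num) ?_ coeff_psiSeries
    coeff_expand_two_jacobiSeries n
  · simpa [psiJacobi] using this
  · intro i j hij hi hj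
    obtain ⟨k, rfl⟩ := exists_of_coeff_sparseSeries_ne_zero hi
    obtain ⟨j, rfl⟩ : 2 ∣ j := by
      by_contra h
      exact hj (coeff_expand_of_not_dvd _ _ _ h)
    rw [coeff_expand_mul] at hj
    obtain ⟨l, rfl⟩ := exists_of_coeff_sparseSeries_ne_zero hj
    rcases triNum_mod_five k with ⟨-, i, h⟩ | h <;> rcases triNum_mod_five l with ⟨-, j, h'⟩ | h'
    · exact ⟨⟨i, h⟩, 2 * j, by omega⟩
    all_goals omega

theorem genM_eq : genM = expand 5 (by norm_num) phiJacobi * psiJacobi := by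
  have h : fq 1 * fq 10 ≠ 0 := mul_ne_zero (fq_ne_zero 1 le_rfl) (fq_ne_zero 10 (by norm_num))
  refine mul_right_cancel₀ h ?_
  have h5 := congrArg (expand 5 (by norm_num)) fq_two_mul_phiJacobi
  rw [map_mul, map_pow, expand_fq _ _ _ (by norm_num), expand_fq _ _ _ le_rfl] at h5
  rw [genM_mul]
  linear_combination -fq 1 * psiJacobi * h5 - fq 5 ^ 5 * fq_one_mul_psiJacobi

theorem pvM_five_mul_add_four (n : ℕ) : pvM (5 * n + 4) =
    5 * coeff n (X * (expand 5 (by norm_num) psiJacobi * phiJacobi)) := by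
  have : (mk fun k => coeff (5 * k + 4) psiJacobi) =
      C 5 * (X * expand 5 (by norm_num) psiJacobi) := by
    ext k
    rw [coeff_mk, coeff_C_mul, coeff_psiJacobi]
  rw [pvM, genM_eq, coeff_expand_mul_left _ _ _ _ (by norm_num), this, ← coeff_C_mul]
  congr 1
  ring

theorem coeff_five_mul_add_three (n : ℕ) :
    coeff (5 * n + 3) (expand 5 (by norm_num) psiJacobi * phiJacobi) = 5 * pvM n := by
  have : (mk fun k => coeff (5 * k + 3) phiJacobi) =
      C 5 * expand 5 (by norm_num) phiJacobi := by
    ext k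
    rw [coeff_mk, coeff_C_mul, coeff_phiJacobi]
  rw [coeff_expand_mul_left _ _ _ _ (by norm_num), this, pvM, genM_eq, ← coeff_C_mul]
  congr 1
  ring

theorem pvM_twentyFive (n : ℕ) : pvM (25 * n + 24) = 25 * pvM n := by
  -- The factor X from the first dissection lowers the index 5n+4 to 5n+3, the class needed for the
  -- second.
  rw [show 25 * n + 24 = 5 * (5 * n + 3 + 1) + 4 by ring, pvM_five_mul_add_four, coeff_succ_X_mul,
    coeff_five_mul_add_three]
  ring

theorem dvd_pvM (α n : ℕ) : (5 : ℤ) ^ α ∣ pvM (5 ^ α * n + 5 ^ α - 1) := by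
  induction α using Nat.twoStepInduction generalizing n with
  | zero => simp
  | one =>
    rw [show 5 ^ 1 * n + 5 ^ 1 - 1 = 5 * n + 4 by omega, pvM_five_mul_add_four, pow_one]
    exact dvd_mul_right _ _
  | more α ih _ =>
    have h : 5 ^ (α + 2) * n + 5 ^ (α + 2) - 1 = 25 * (5 ^ α * n + 5 ^ α - 1) + 24 := by
      have : 0 < 5 ^ α := by positivity
      rw [pow_add, mul_right_comm]
      omega
    rw [h, pvM_twentyFive, pow_add, mul_comm]
    exact mul_dvd_mul (by norm_num) (ih n)

theorem mainTheorem6 (n α : ℕ) (hα : 1 ≤ α) :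
    pvM (5 ^ α * n + 5 ^ α - 1) ≡ 0 [ZMOD (5 : ℤ) ^ α] := by
  exact Int.modEq_zero_iff_dvd.mpr (dvd_pvM α n)
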